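/- Let $X$ be a real Banach space with closed unit ball $\bar{\mathbf B}$, let $A,B\subset X$ be closed and let $x_0\in A\cap B$. We use the following notions. The Clarke tangent cone $\hat T_S(x_0)$ to a closed set $S\ni x_0$ is the set of all $v\in X$ such that for each $\varepsilon>0$ there exist $\delta>0$ and $\lambda>0$ such that $S\cap(x+t(v+\varepsilon\bar{\mathbf B}))\neq\emptyset$ for all $x\in S\cap(x_0+\delta\bar{\mathbf B})$ and all $t\in[0,\lambda]$. The Clarke normal cone is its polar cone $N_S(x_0)=\{x^*\in X^* : \langle x^*,v\rangle\le 0 \text{ for all } v\in\hat T_S(x_0)\}$. A set $\Omega\subset X$ is finite codimensional if there is $z\in\overline{\mathrm{co}}\,\Omega$ such that $\overline{\mathrm{span}}(\Omega-z)$ is a subspace of finite codimension in $X$ and $\overline{\mathrm{co}}(\Omega-z)$ has nonempty interior in this subspace. The set $A$ is epi-Lipschitz-like at $x_0$ if there exist $\delta>0$, a convex finite codimensional set $\Omega\subset X$ and $\eta>0$ such that $y+t\Omega\subset A$ for all $y\in(x_0+\delta\bar{\mathbf B})\cap A$ and all $t\in(0,\eta)$. The sets $A$ and $B$ are tangentially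 transversal at $x_0$ if there exist $M>0$, $\delta>0$ and $\eta>0$ such that for any two different points $x^A\in(x_0+\delta\bar{\mathbf B})\cap A$ and $x^B\in(x_0+\delta\bar{\mathbf B})\cap B$ there is a sequence $t_m\searrow0$ of positive reals such that for every $m$ there exist $w^A_m,w^B_m\in X$ of norm at most $M$ with $x^A+t_mw^A_m\in A$, $x^B+t_mw^B_m\in B$ and $\|x^A-x^B+t_m(w^A_m-w^B_m)\|\le\|x^A-x^B\|-t_m\eta$. **Statement.** Suppose that $A$ is epi-Lipschitz-like at $x_0$ and that $\hat T_A(x_0)-\hat T_B(x_0)$ is dense in $X$. Then $A$ and $B$ are tangentially transversal at $x_0$, and they have the normal intersection property at $x_0$ with respect to the Clarke normal cones, that is, $N_{A\cap B}(x_0)\subset N_A(x_0)+N_B(x_0)$ and $N_A(x_0)+N_B(x_0)$ is weak$^*$-closed in $X^*$. -/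

import Mathlib

open Filter Metric
open scoped Topology Pointwise

/-- The Clarke tangent cone to `S` at `x₀`: all `v` such that for each `ε > 0` there are
`δ > 0` and `lam > 0` such that `S ∩ (x + t (v + ε B̄))` is nonempty for every
`x ∈ S ∩ (x₀ + δ B̄)` and every `t ∈ [0, lam]`. -/
def clarkeTangentCone {X : Type*} [NormedAddCommGroup X] [NormedSpace ℝ X]
    (S : Set X) (x₀ : X) : Set X :=
  {v | ∀ ε > (0 : ℝ), ∃ δ > (0 : ℝ), ∃ lam > (0 : ℝ),
    ∀ x ∈ S ∩ closedBall x₀ δ, ∀ t ∈ Set.Icc (0 : ℝ) lam,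
      ∃ w ∈ closedBall v ε, x + t • w ∈ S}

/-- The Clarke normal cone to `S` at `x₀`: the polar cone of the Clarke tangent cone, a subset
of the topological dual, which is equipped here with the weak-star topology. -/
def clarkeNormalCone {X : Type*} [NormedAddCommGroup X] [NormedSpace ℝ X]
    (S : Set X) (x₀ : X) : Set (WeakDual ℝ X) :=
  {f | ∀ v ∈ clarkeTangentCone S x₀, f v ≤ 0}

/-- `A` and `B` are tangentially transversal at `x₀`. The points `xA` and `xB` are required to be
different, since the last inequality cannot hold for `xA = xB`. -/
def TangentiallyTransversal {X : Type*} [NormedAddCommGroup X] [NormedSpace ℝ X]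
    (A B : Set X) (x₀ : X) : Prop :=
  ∃ M > (0 : ℝ), ∃ δ > (0 : ℝ), ∃ η > (0 : ℝ),
    ∀ xA ∈ closedBall x₀ δ ∩ A, ∀ xB ∈ closedBall x₀ δ ∩ B, xA ≠ xB →
      ∃ t : ℕ → ℝ, (∀ m, 0 < t m) ∧ StrictAnti t ∧ Tendsto t atTop (𝓝 0) ∧
        ∀ m, ∃ wA wB : X, ‖wA‖ ≤ M ∧ xA + t m • wA ∈ A ∧ ‖wB‖ ≤ M ∧ xB + t m • wB ∈ B ∧
          ‖xA - xB + t m • (wA - wB)‖ ≤ ‖xA - xB‖ - t m * η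

/-- The normal intersection property of `A` and `B` at `x₀` with respect to a type `N` of
normal cone (`N S x` being the normal cone to `S` at `x`). The closedness of the sum refers to
the weak-star topology. -/
def NormalIntersectionProperty {X : Type*} [NormedAddCommGroup X] [NormedSpace ℝ X]
    (N : Set X → X → Set (WeakDual ℝ X)) (A B : Set X) (x₀ : X) : Prop :=
  N (A ∩ B) x₀ ⊆ N A x₀ + N B x₀ ∧ IsClosed (N A x₀ + N B x₀)

/-- The closed linear span of `S - x₀`. -/
def closedSpanTranslate {X : Type*} [NormedAddCommGroup X] [NormedSpace ℝ X]
    (S : Set X) (x₀ : X) : Submodule ℝ X :=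
  (Submodule.span ℝ ((fun s => s - x₀) '' S)).topologicalClosure

/-- `S` is finite codimensional: for some `x₀` in the closed convex hull of `S`, the closed
span of `S - x₀` has finite codimension in the whole space, and the closed convex hull of `S - x₀`
has nonempty interior relative to this closed span. -/
def FiniteCodimensionalSet {X : Type*} [NormedAddCommGroup X] [NormedSpace ℝ X]
    (S : Set X) : Prop :=
  ∃ x₀ ∈ closure (convexHull ℝ S),
    FiniteDimensional ℝ (X ⧸ closedSpanTranslate S x₀) ∧
    (interior {u : closedSpanTranslate S x₀ |
      (u : X) ∈ closure (convexHull ℝ ((fun s => s - x₀) '' S))}).Nonempty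

/-- `S` is epi-Lipschitz-like at `x`. -/
def EpiLipschitzLike {X : Type*} [NormedAddCommGroup X] [NormedSpace ℝ X]
    (S : Set X) (x : X) : Prop :=
  ∃ δ > (0 : ℝ), ∃ Ω : Set X, Convex ℝ Ω ∧ FiniteCodimensionalSet Ω ∧ ∃ η > (0 : ℝ),
    ∀ y ∈ closedBall x δ ∩ S, ∀ t ∈ Set.Ioo (0 : ℝ) η, ∀ w ∈ Ω, y + t • w ∈ S

/-!
The proof rests on *uniform tangent sets*: sets `D` of directions for which the `δ` and `lam` in the
definition of the Clarke tangent cone can be chosen independently of the direction in `D`. Such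
sets are stable under closures, finite unions and sums of bounded sets.

The convex set `Ω` from the epi-Lipschitz-like property is a uniform tangent set to `A`, hence so
is its closure, and the latter contains `w + r 𝔹_L` for a closed subspace `L` of finite codimension.
Modulo `r 𝔹_L`, a small ball of `X` is totally bounded, so by density of the difference of the
tangent cones finitely many differences `a i - b i` complement `w + r 𝔹_L` to a covering:
`D_A = w + r 𝔹_L + {a i}` and `D_B = {b i}` are bounded uniform tangent sets, and `D_A - D_B` meets
`x + (s / 4) 𝔹` for every `x` in a ball of radius `s` (`exists_isUniformTangentSet_cover`).

Moving two points of `A` and `B` along such directions decreases their distance at a linear rate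
(`exists_linear_decrease`). This is tangential transversality. As the steps may be taken so long
that the distance is halved, iterating them also yields a point of `A ∩ B` whose distance to
`xA ∈ A` is at most a multiple of `‖xA - xB‖` (`exists_mem_inter_of_halving`), and therefore the
inclusion of `T_A ∩ T_B` in the Clarke tangent cone to `A ∩ B`.

The same iteration, run on the convex cones `T_A` and `T_B` themselves, writes every `x` as `p - q`
with `p ∈ T_A`, `q ∈ T_B` and `‖q‖ ≤ K ‖x‖`. By the Hahn-Banach theorem for sublinear functionals
the polar of `T_A ∩ T_B` is then exactly `N_A + N_B` (`ConvexCone.exists_add_of_nonpos_inter`). A polar is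
weak-star closed, so the sum is closed without any appeal to the Krein-Smulian theorem.
-/

section

variable {X : Type*} [NormedAddCommGroup X]

/-! ### Common points of closed sets by halving the distance -/

/-- If any two points of the closed sets `A` and `B` in the ball `x₀ + δ 𝔹` can be replaced by points
of `A` and `B` at half the distance, the displacements being at most `K` times the distance, then
iteration converges to a common point of `A` and `B`. -/
theorem exists_mem_inter_of_halving [CompleteSpace X] {A B : Set X} (hA : IsClosed A)
    (hB : IsClosed B) {x₀ : X} {δ K : ℝ}
    (hstep : ∀ xA ∈ A ∩ closedBall x₀ δ, ∀ xB ∈ B ∩ closedBall x₀ δ, ∃ yA ∈ A, ∃ yB ∈ B,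
      ‖yA - xA‖ ≤ K * ‖xA - xB‖ ∧ ‖yB - xB‖ ≤ K * ‖xA - xB‖ ∧ ‖yA - yB‖ ≤ ‖xA - xB‖ / 2)
    (hK : 0 ≤ K) {xA xB : X} (hxA : xA ∈ A) (hxB : xB ∈ B)
    (hxA' : ‖xA - x₀‖ + 2 * K * ‖xA - xB‖ ≤ δ) (hxB' : ‖xB - x₀‖ + 2 * K * ‖xA - xB‖ ≤ δ) :
    ∃ y ∈ A ∩ B, ‖y - xA‖ ≤ 2 * K * ‖xA - xB‖ := by
  set d := ‖xA - xB‖ with hd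
  have hd0 : 0 ≤ d := norm_nonneg _
  have hstep' : ∀ xA xB, xA ∈ A ∩ closedBall x₀ δ ∧ xB ∈ B ∩ closedBall x₀ δ →
      ∃ yA yB, yA ∈ A ∧ yB ∈ B ∧ ‖yA - xA‖ ≤ K * ‖xA - xB‖ ∧ ‖yB - xB‖ ≤ K * ‖xA - xB‖ ∧
        ‖yA - yB‖ ≤ ‖xA - xB‖ / 2 := fun xA xB h =>
    let ⟨yA, hyA, yB, hyB, hy⟩ := hstep xA h.1 xB h.2
    ⟨yA, yB, hyA, hyB, hy⟩
  choose! F G hFA hGB hF hG hFG using hstep'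
  let z : ℕ → X × X := fun n => (fun p => (F p.1 p.2, G p.1 p.2))^[n] (xA, xB)
  have hz : ∀ n, z (n + 1) = (F (z n).1 (z n).2, G (z n).1 (z n).2) := fun n =>
    Function.iterate_succ_apply' _ _ _
  -- the total displacement after `n` steps is at most `K d + K d / 2 + ⋯ = 2 K d (1 - 2⁻ⁿ)`
  have inv : ∀ n, (z n).1 ∈ A ∧ (z n).2 ∈ B ∧ ‖(z n).1 - (z n).2‖ ≤ d / 2 ^ n ∧
      ‖(z n).1 - xA‖ ≤ 2 * K * d * (1 - 1 / 2 ^ n) ∧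
      ‖(z n).2 - xB‖ ≤ 2 * K * d * (1 - 1 / 2 ^ n) ∧
      ‖(z (n + 1)).1 - (z n).1‖ ≤ 2 * K * d / 2 / 2 ^ n := by
    have hball : ∀ {x y : X} (n : ℕ), ‖x - x₀‖ + 2 * K * d ≤ δ →
        ‖y - x‖ ≤ 2 * K * d * (1 - 1 / 2 ^ n) → y ∈ closedBall x₀ δ := by
      intro x y n hx hy
      rw [mem_closedBall, dist_eq_norm]
      have h1 := norm_add_le (y - x) (x - x₀)
      rw [sub_add_sub_cancel] at h1
      have h2 : 2 * K * d * (1 - 1 / 2 ^ n) ≤ 2 * K * d :=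
        mul_le_of_le_one_right (by positivity) (sub_le_self _ (by positivity))
      linarith
    intro n
    induction n with
    | zero =>
      have h0 := hF xA xB ⟨⟨hxA, hball 0 hxA' (by simp)⟩, ⟨hxB, hball 0 hxB' (by simp)⟩⟩
      refine ⟨hxA, hxB, by simp [z, hd], by simp [z], by simp [z], ?_⟩
      rw [hz]
      simpa [z, mul_assoc] using h0
    | succ n ih =>
      obtain ⟨hzA, hzB, hzd, hzA', hzB', -⟩ := ih
      have hp : (z n).1 ∈ A ∩ closedBall x₀ δ ∧ (z n).2 ∈ B ∩ closedBall x₀ δ :=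
        ⟨⟨hzA, hball n hxA' hzA'⟩, ⟨hzB, hball n hxB' hzB'⟩⟩
      have hsum : ∀ {x y w : X}, ‖y - x‖ ≤ 2 * K * d * (1 - 1 / 2 ^ n) →
          ‖w - y‖ ≤ K * ‖(z n).1 - (z n).2‖ → ‖w - x‖ ≤ 2 * K * d * (1 - 1 / 2 ^ (n + 1)) := by
        intro x y w h1 h2
        have h3 := norm_add_le (w - y) (y - x)
        rw [sub_add_sub_cancel] at h3
        have h4 : K * ‖(z n).1 - (z n).2‖ ≤ K * (d / 2 ^ n) := by gcongr
        have h5 : 2 * K * d * (1 - 1 / 2 ^ n) + K * (d / 2 ^ n) =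
            2 * K * d * (1 - 1 / 2 ^ (n + 1)) := by
          rw [pow_succ]; field_simp; ring
        linarith
      have hA1 : (z (n + 1)).1 ∈ A := by rw [hz]; exact hFA _ _ hp
      have hB1 : (z (n + 1)).2 ∈ B := by rw [hz]; exact hGB _ _ hp
      have hd1 : ‖(z (n + 1)).1 - (z (n + 1)).2‖ ≤ d / 2 ^ (n + 1) := by
        have h1 := hFG _ _ hp
        rw [hz, pow_succ, ← div_div]
        linarith
      have hA2 : ‖(z (n + 1)).1 - xA‖ ≤ 2 * K * d * (1 - 1 / 2 ^ (n + 1)) := by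
        rw [hz]; exact hsum hzA' (hF _ _ hp)
      have hB2 : ‖(z (n + 1)).2 - xB‖ ≤ 2 * K * d * (1 - 1 / 2 ^ (n + 1)) := by
        rw [hz]; exact hsum hzB' (hG _ _ hp)
      refine ⟨hA1, hB1, hd1, hA2, hB2, ?_⟩
      rw [hz (n + 1)]
      refine (hF _ _ ⟨⟨hA1, hball _ hxA' hA2⟩, ⟨hB1, hball _ hxB' hB2⟩⟩).trans ?_
      rw [show 2 * K * d / 2 / 2 ^ (n + 1) = K * (d / 2 ^ (n + 1)) by ring]
      gcongr
  have hdist : ∀ n, dist (z n).1 (z (n + 1)).1 ≤ 2 * K * d / 2 / 2 ^ n := fun n => by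
    rw [dist_comm, dist_eq_norm]
    exact (inv n).2.2.2.2.2
  obtain ⟨y, hy⟩ := cauchySeq_tendsto_of_complete (cauchySeq_of_le_geometric_two hdist)
  have hgap : Tendsto (fun n => (z n).1 - (z n).2) atTop (𝓝 0) := by
    refine squeeze_zero_norm (fun n => (inv n).2.2.1) ?_
    simpa [div_eq_mul_inv] using
      (tendsto_pow_atTop_nhds_zero_of_lt_one (by norm_num) (by norm_num :
        (2⁻¹ : ℝ) < 1)).const_mul d
  have hy' : Tendsto (fun n => (z n).2) atTop (𝓝 y) := by
    simpa using hy.sub hgap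
  refine ⟨y, ⟨hA.mem_of_tendsto hy (.of_forall fun n => (inv n).1),
    hB.mem_of_tendsto hy' (.of_forall fun n => (inv n).2.1)⟩, ?_⟩
  have := dist_le_of_le_geometric_two_of_tendsto₀ hdist hy
  rwa [dist_comm, dist_eq_norm] at this

variable [NormedSpace ℝ X]

/-! ### Uniform tangent sets -/

/-- `D` is a uniform tangent set to `S` at `x₀`: in the definition of the Clarke tangent cone, `δ`
and `lam` depend on `ε` only, and not on the direction `v ∈ D`. -/
def IsUniformTangentSet (S : Set X) (x₀ : X) (D : Set X) : Prop :=
  ∀ ε > (0 : ℝ), ∃ δ > (0 : ℝ), ∃ lam > (0 : ℝ),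
    ∀ x ∈ S ∩ closedBall x₀ δ, ∀ t ∈ Set.Icc (0 : ℝ) lam, ∀ v ∈ D,
      ∃ w ∈ closedBall v ε, x + t • w ∈ S

namespace IsUniformTangentSet

variable {S : Set X} {x₀ : X} {D D' : Set X}

theorem mono (h : IsUniformTangentSet S x₀ D') (hD : D ⊆ D') : IsUniformTangentSet S x₀ D := by
  intro ε hε
  obtain ⟨δ, hδ, lam, hlam, H⟩ := h ε hε
  exact ⟨δ, hδ, lam, hlam, fun x hx t ht v hv => H x hx t ht v (hD hv)⟩

theorem subset_clarkeTangentCone (h : IsUniformTangentSet S x₀ D) :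
    D ⊆ clarkeTangentCone S x₀ := by
  intro v hv ε hε
  obtain ⟨δ, hδ, lam, hlam, H⟩ := h ε hε
  exact ⟨δ, hδ, lam, hlam, fun x hx t ht => H x hx t ht v hv⟩

theorem singleton_iff {v : X} :
    IsUniformTangentSet S x₀ {v} ↔ v ∈ clarkeTangentCone S x₀ := by
  simp only [IsUniformTangentSet, clarkeTangentCone, Set.mem_singleton_iff, forall_eq,
    Set.mem_ofPred_eq]

theorem closure (h : IsUniformTangentSet S x₀ D) : IsUniformTangentSet S x₀ (closure D) := by
  intro ε hε
  obtain ⟨δ, hδ, lam, hlam, H⟩ := h (ε / 2) (by positivity)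
  refine ⟨δ, hδ, lam, hlam, fun x hx t ht v hv => ?_⟩
  obtain ⟨v', hv', hvv'⟩ := Metric.mem_closure_iff.1 hv (ε / 2) (by positivity)
  obtain ⟨w, hw, hxw⟩ := H x hx t ht v' hv'
  refine ⟨w, ?_, hxw⟩
  rw [mem_closedBall] at hw ⊢
  have := dist_triangle w v' v
  rw [dist_comm v' v] at this
  linarith

theorem union (h : IsUniformTangentSet S x₀ D) (h' : IsUniformTangentSet S x₀ D') :
    IsUniformTangentSet S x₀ (D ∪ D') := by
  intro ε hε
  obtain ⟨δ, hδ, lam, hlam, H⟩ := h ε hε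
  obtain ⟨δ', hδ', lam', hlam', H'⟩ := h' ε hε
  refine ⟨min δ δ', lt_min hδ hδ', min lam lam', lt_min hlam hlam', ?_⟩
  rintro x ⟨hxS, hx⟩ t ⟨ht0, ht⟩ v (hv | hv)
  · exact H x ⟨hxS, closedBall_subset_closedBall (min_le_left _ _) hx⟩ t
      ⟨ht0, ht.trans (min_le_left _ _)⟩ v hv
  · exact H' x ⟨hxS, closedBall_subset_closedBall (min_le_right _ _) hx⟩ t
      ⟨ht0, ht.trans (min_le_right _ _)⟩ v hv

theorem of_finite (hD : D.Finite) (h : D ⊆ clarkeTangentCone S x₀) :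
    IsUniformTangentSet S x₀ D := by
  induction D, hD using Set.Finite.induction_on with
  | empty => exact fun ε _ => ⟨1, one_pos, 1, one_pos, by simp⟩
  | @insert a s _ _ ih =>
    rw [Set.insert_eq]
    exact (singleton_iff.2 (h (Set.mem_insert _ _))).union
      (ih ((Set.subset_insert _ _).trans h))

theorem add (hD : Bornology.IsBounded D) (h : IsUniformTangentSet S x₀ D)
    (h' : IsUniformTangentSet S x₀ D') : IsUniformTangentSet S x₀ (D + D') := by
  intro ε hε
  obtain ⟨M, hM0, hM⟩ := hD.exists_pos_norm_le
  obtain ⟨δ, hδ, lam, hlam, H⟩ := h (min (ε / 2) 1) (by positivity)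
  obtain ⟨δ', hδ', lam', hlam', H'⟩ := h' (ε / 2) (by positivity)
  refine ⟨min δ (δ' / 2), by positivity, min lam (min lam' (δ' / (2 * (M + 1)))),
    by positivity, ?_⟩
  rintro x ⟨hxS, hx⟩ t ⟨ht0, ht⟩ _ ⟨v, hv, v', hv', rfl⟩
  simp only [le_min_iff] at ht
  obtain ⟨w, hw, hxw⟩ := H x ⟨hxS, closedBall_subset_closedBall (min_le_left _ _) hx⟩ t
    ⟨ht0, ht.1⟩ v hv
  rw [mem_closedBall, dist_eq_norm, le_min_iff] at hw
  have hwM : ‖w‖ ≤ M + 1 := by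
    have h1 := norm_add_le (w - v) v
    rw [sub_add_cancel] at h1
    linarith [hM v hv]
  have hxw' : x + t • w ∈ closedBall x₀ δ' := by
    rw [mem_closedBall, dist_eq_norm] at hx ⊢
    have h1 : ‖t • w‖ ≤ δ' / 2 := by
      rw [norm_smul, Real.norm_of_nonneg ht0]
      calc t * ‖w‖ ≤ δ' / (2 * (M + 1)) * (M + 1) := by gcongr; exact ht.2.2
        _ = δ' / 2 := by field_simp
    have h2 := norm_add_le (x - x₀) (t • w)
    rw [show x - x₀ + t • w = x + t • w - x₀ by abel] at h2
    linarith [hx.trans (min_le_right _ _)]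
  obtain ⟨w', hw', hxw''⟩ := H' _ ⟨hxw, hxw'⟩ t ⟨ht0, ht.2.1⟩ v' hv'
  refine ⟨w + w', ?_, by rwa [smul_add, ← add_assoc]⟩
  rw [mem_closedBall] at hw' ⊢
  have h3 := dist_add_add_le w w' v v'
  rw [dist_eq_norm w v] at h3
  linarith

end IsUniformTangentSet

/-! ### The Clarke tangent cone -/

theorem isClosed_clarkeTangentCone (S : Set X) (x₀ : X) : IsClosed (clarkeTangentCone S x₀) := by
  refine isClosed_of_closure_subset fun v hv ε hε => ?_
  obtain ⟨v', hv', hvv'⟩ := Metric.mem_closure_iff.1 hv (ε / 2) (by positivity)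
  obtain ⟨δ, hδ, lam, hlam, H⟩ := hv' (ε / 2) (by positivity)
  refine ⟨δ, hδ, lam, hlam, fun x hx t ht => ?_⟩
  obtain ⟨w, hw, hxw⟩ := H x hx t ht
  refine ⟨w, ?_, hxw⟩
  rw [mem_closedBall] at hw ⊢
  have := dist_triangle w v' v
  rw [dist_comm v' v] at this
  linarith

theorem add_mem_clarkeTangentCone {S : Set X} {x₀ v v' : X} (h : v ∈ clarkeTangentCone S x₀)
    (h' : v' ∈ clarkeTangentCone S x₀) : v + v' ∈ clarkeTangentCone S x₀ := by
  rw [← IsUniformTangentSet.singleton_iff] at h h' ⊢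
  simpa using h.add Bornology.isBounded_singleton h'

theorem smul_mem_clarkeTangentCone {S : Set X} {x₀ v : X} {c : ℝ} (hc : 0 < c)
    (h : v ∈ clarkeTangentCone S x₀) : c • v ∈ clarkeTangentCone S x₀ := by
  intro ε hε
  obtain ⟨δ, hδ, lam, hlam, H⟩ := h (ε / c) (by positivity)
  refine ⟨δ, hδ, lam / c, by positivity, fun x hx t ht => ?_⟩
  obtain ⟨w, hw, hxw⟩ := H x hx (t * c)
    ⟨mul_nonneg ht.1 hc.le, (le_div_iff₀ hc).1 ht.2⟩
  refine ⟨c • w, ?_, by rwa [smul_smul]⟩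
  rw [mem_closedBall] at hw ⊢
  rw [dist_smul₀, Real.norm_of_nonneg hc.le, mul_comm]
  exact (le_div_iff₀ hc).1 hw

theorem zero_mem_clarkeTangentCone (S : Set X) (x₀ : X) : 0 ∈ clarkeTangentCone S x₀ :=
  fun ε hε => ⟨1, one_pos, 1, one_pos, fun x hx t _ => ⟨0, by simp [hε.le], by simpa using hx.1⟩⟩

/-- The Clarke tangent cone as a bundled convex cone. -/
def clarkeTangentConvexCone (S : Set X) (x₀ : X) : ConvexCone ℝ X where
  carrier := clarkeTangentCone S x₀
  smul_mem' _ hc _ h := smul_mem_clarkeTangentCone hc h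
  add_mem' _ h _ h' := add_mem_clarkeTangentCone h h'

/-! ### A covering by differences of uniform tangent sets -/

/-- A small ball of `X` is covered, up to an error `ε` times its radius, by finitely many translates
of a ball in a closed subspace of finite codimension. -/
theorem Submodule.exists_finite_cover_of_finiteDimensional_quotient [CompleteSpace X]
    (L : Submodule ℝ X) (hL : IsClosed (L : Set X)) [FiniteDimensional ℝ (X ⧸ L)] {r ε : ℝ}
    (hr : 0 < r) (hε : 0 < ε) :
    ∃ s > (0 : ℝ), ∃ E : Set X, E.Finite ∧
      ∀ x : X, ‖x‖ ≤ s → ∃ e ∈ E, ∃ l ∈ L, ‖l‖ ≤ r ∧ ‖x - e - l‖ ≤ s * ε := by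
  obtain ⟨f, hf⟩ := Submodule.ClosedComplemented.of_finiteDimensional_quotient (p := L) hL
  have hcompl : IsCompl L f.ker := LinearMap.isCompl_of_proj hf
  have : FiniteDimensional ℝ f.ker :=
    (Submodule.quotientEquivOfIsCompl _ _ hcompl).finiteDimensional
  have : ProperSpace f.ker := FiniteDimensional.proper ℝ _
  let s := r / (‖f‖ + 1)
  have hs : 0 < s := by positivity
  have hfx : ∀ x : X, ‖x‖ ≤ s → ‖f x‖ ≤ r := fun x hx => by
    calc ‖f x‖ ≤ ‖f‖ * ‖x‖ := f.le_opNorm x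
      _ ≤ (‖f‖ + 1) * s := by gcongr; linarith
      _ = r := by simp only [s]; field_simp
  have hcomp : IsCompact (((↑) : f.ker → X) '' closedBall 0 (s + r)) :=
    (isCompact_closedBall _ _).image continuous_subtype_val
  obtain ⟨E, -, hE, hcov⟩ := hcomp.finite_cover_balls (e := s * ε) (by positivity)
  refine ⟨s, hs, E, hE, fun x hx => ?_⟩
  have hmem : x - f x ∈ ((↑) : f.ker → X) '' closedBall 0 (s + r) := by
    refine ⟨⟨x - f x, ?_⟩, ?_, rfl⟩
    · rw [LinearMap.mem_ker]
      simp [hf]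
    · rw [mem_closedBall_zero_iff]
      exact (norm_sub_le _ _).trans (add_le_add hx (hfx x hx))
  obtain ⟨e, he, hd⟩ := Set.mem_iUnion₂.1 (hcov hmem)
  refine ⟨e, he, f x, (f x).2, hfx x hx, ?_⟩
  rw [mem_ball, dist_eq_norm] at hd
  rw [show x - e - (f x : X) = x - f x - e by abel]
  exact hd.le

/-- An epi-Lipschitz-like set has a uniform tangent set of the form `w + r 𝔹_L`, with `L` a closed
subspace of finite codimension. -/
theorem EpiLipschitzLike.exists_isUniformTangentSet {A : Set X} {x₀ : X}
    (h : EpiLipschitzLike A x₀) :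
    ∃ L : Submodule ℝ X, IsClosed (L : Set X) ∧ FiniteDimensional ℝ (X ⧸ L) ∧
      ∃ w : X, ∃ r > (0 : ℝ),
        IsUniformTangentSet A x₀ ((fun l => w + l) '' {l | l ∈ L ∧ ‖l‖ ≤ r}) := by
  obtain ⟨δ, hδ, Ω, hconv, ⟨z, -, hfin, u, hu⟩, η, hη, H⟩ := h
  obtain ⟨r, hr, hball⟩ := Metric.nhds_basis_closedBall.mem_iff.1 (mem_interior_iff_mem_nhds.1 hu)
  have hΩ : IsUniformTangentSet A x₀ Ω := by
    refine fun ε hε => ⟨δ, hδ, η / 2, by positivity, fun x hx t ht v hv => ⟨v, by simp [hε.le], ?_⟩⟩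
    rcases ht.1.eq_or_lt with rfl | ht0
    · simpa using hx.1
    · exact H x ⟨hx.2, hx.1⟩ t ⟨ht0, ht.2.trans_lt (half_lt_self hη)⟩ v hv
  refine ⟨closedSpanTranslate Ω z, Submodule.isClosed_topologicalClosure _, hfin, z + u, r, hr,
    hΩ.closure.mono ?_⟩
  rintro _ ⟨l, ⟨hl, hlr⟩, rfl⟩
  have h1 : ((u + ⟨l, hl⟩ : closedSpanTranslate Ω z) : X) ∈
      closure (convexHull ℝ ((fun s => s - z) '' Ω)) := by
    refine hball ?_
    rw [mem_closedBall, dist_eq_norm, add_sub_cancel_left]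
    exact hlr
  have hconv' : Convex ℝ ((fun s => s - z) '' Ω) := by
    simpa [sub_eq_neg_add] using hconv.translate (-z)
  rw [hconv'.convexHull_eq] at h1
  have h2 := map_mem_closure (f := fun y : X => z + y) (t := Ω) (by fun_prop) h1 (by
    rintro _ ⟨y, hy, rfl⟩
    simpa using hy)
  simpa [add_assoc] using h2

/-- The two hypotheses of the theorem combined: the difference of two bounded uniform tangent sets
meets `x + (s / 4) 𝔹` for every `x` in a ball of radius `s`. -/
theorem exists_isUniformTangentSet_cover [CompleteSpace X] {A B : Set X} {x₀ : X}
    (hell : EpiLipschitzLike A x₀)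
    (hdense : Dense (clarkeTangentCone A x₀ - clarkeTangentCone B x₀)) :
    ∃ DA DB : Set X, Bornology.IsBounded DA ∧ Bornology.IsBounded DB ∧
      IsUniformTangentSet A x₀ DA ∧ IsUniformTangentSet B x₀ DB ∧
      ∃ s > (0 : ℝ), ∀ x : X, ‖x‖ ≤ s → ∃ a ∈ DA, ∃ b ∈ DB, ‖a - b - x‖ ≤ s / 4 := by
  obtain ⟨L, hL, hfin, w, r, hr, hD⟩ := hell.exists_isUniformTangentSet
  obtain ⟨s, hs, E, hE, hcov⟩ :=
    L.exists_finite_cover_of_finiteDimensional_quotient hL hr (ε := 1 / 8) (by norm_num)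
  -- the differences `a e - b e` approximate `e - w`, so that the centre `w` cancels in the sum
  have happrox : ∀ e : X, ∃ a ∈ clarkeTangentCone A x₀, ∃ b ∈ clarkeTangentCone B x₀,
      ‖e - w - (a - b)‖ < s / 8 := by
    intro e
    obtain ⟨_, ⟨a, ha, b, hb, rfl⟩, hd⟩ := hdense.exists_dist_lt (e - w) (ε := s / 8)
      (by positivity)
    exact ⟨a, ha, b, hb, by simpa [dist_eq_norm] using hd⟩
  choose a ha b hb hab using happrox
  have hbdd : Bornology.IsBounded ((fun l => w + l) '' {l | l ∈ L ∧ ‖l‖ ≤ r}) := by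
    refine isBounded_iff_forall_norm_le.2 ⟨‖w‖ + r, ?_⟩
    rintro _ ⟨l, hl, rfl⟩
    exact (norm_add_le _ _).trans (by linarith [hl.2])
  refine ⟨(fun l => w + l) '' {l | l ∈ L ∧ ‖l‖ ≤ r} + a '' E, b '' E,
    hbdd.add (hE.image a).isBounded, (hE.image b).isBounded,
    hD.add hbdd (.of_finite (hE.image a) ?_), .of_finite (hE.image b) ?_, s, hs, fun x hx => ?_⟩
  · rintro _ ⟨e, -, rfl⟩; exact ha e
  · rintro _ ⟨e, -, rfl⟩; exact hb e
  · obtain ⟨e, he, l, hl, hlr, hxe⟩ := hcov x hx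
    refine ⟨_, Set.add_mem_add ⟨l, ⟨hl, hlr⟩, rfl⟩ ⟨e, he, rfl⟩, _, ⟨e, he, rfl⟩, ?_⟩
    have h1 := norm_add_le (x - e - l) (e - w - (a e - b e))
    rw [← norm_neg (x - e - l + _)] at h1
    rw [show w + l + a e - b e - x = -(x - e - l + (e - w - (a e - b e))) by abel]
    linarith [hab e]

/-! ### Linear decrease of the distance -/

/-- If `v` is within `s / 2` of the vector of length `s` pointing from `u` to the origin, then
moving `u` along `v` decreases the norm at rate `s / 2`, as long as the origin is not passed. -/
theorem norm_add_smul_le_of_near {u v : X} {s t : ℝ} (ht : 0 ≤ t) (hs : 0 < s) (hts : t * s ≤ ‖u‖)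
    (hv : ‖v - (-(s / ‖u‖)) • u‖ ≤ s / 2) : ‖u + t • v‖ ≤ ‖u‖ - t * (s / 2) := by
  rcases eq_or_ne u 0 with rfl | hu
  · have : t = 0 := by rw [norm_zero] at hts; nlinarith
    simp [this]
  have hn : 0 < ‖u‖ := norm_pos_iff.2 hu
  have h1 : u + t • v = (1 - t * (s / ‖u‖)) • u + t • (v - (-(s / ‖u‖)) • u) := by module
  have h2 : 0 ≤ 1 - t * (s / ‖u‖) := by
    rw [← mul_div_assoc, sub_nonneg]
    exact (div_le_one hn).2 hts
  calc ‖u + t • v‖ ≤ (1 - t * (s / ‖u‖)) * ‖u‖ + t * (s / 2) := by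
        rw [h1]
        refine (norm_add_le _ _).trans ?_
        rw [norm_smul, norm_smul, Real.norm_of_nonneg h2, Real.norm_of_nonneg ht]
        gcongr
    _ = ‖u‖ - t * (s / 2) := by field_simp; ring

/-- The vector of length `s` pointing from `u` to the origin; it is `0` for `u = 0`, so that the
bound also holds there. -/
theorem norm_neg_div_smul_self_le (u : X) {s : ℝ} (hs : 0 ≤ s) : ‖(-(s / ‖u‖)) • u‖ ≤ s := by
  rw [norm_smul, norm_neg, norm_div, norm_norm, Real.norm_of_nonneg hs]
  rcases (norm_nonneg u).eq_or_lt with h | h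
  · rwa [← h, mul_zero]
  · exact (div_mul_cancel₀ _ h.ne').le

/-- Points of `A` and `B` near `x₀` can be moved within these sets, for a uniform time and until the
distance is halved, so that their distance decreases at rate `s / 2`. -/
theorem exists_linear_decrease {A B DA DB : Set X} {x₀ : X} (hDA : Bornology.IsBounded DA)
    (hDB : Bornology.IsBounded DB) (hA : IsUniformTangentSet A x₀ DA)
    (hB : IsUniformTangentSet B x₀ DB) {s : ℝ} (hs : 0 < s)
    (hcov : ∀ x : X, ‖x‖ ≤ s → ∃ a ∈ DA, ∃ b ∈ DB, ‖a - b - x‖ ≤ s / 4) :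
    ∃ M > (0 : ℝ), ∃ δ > (0 : ℝ), ∃ lam > (0 : ℝ), ∀ xA ∈ A ∩ closedBall x₀ δ,
      ∀ xB ∈ B ∩ closedBall x₀ δ, ∀ t ∈ Set.Icc (0 : ℝ) lam, t * s ≤ ‖xA - xB‖ →
        ∃ wA wB : X, ‖wA‖ ≤ M ∧ xA + t • wA ∈ A ∧ ‖wB‖ ≤ M ∧ xB + t • wB ∈ B ∧
          ‖xA - xB + t • (wA - wB)‖ ≤ ‖xA - xB‖ - t * (s / 2) := by
  obtain ⟨MA, hMA0, hMA⟩ := hDA.exists_pos_norm_le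
  obtain ⟨MB, hMB0, hMB⟩ := hDB.exists_pos_norm_le
  obtain ⟨δA, hδA, lamA, hlamA, HA⟩ := hA (s / 8) (by positivity)
  obtain ⟨δB, hδB, lamB, hlamB, HB⟩ := hB (s / 8) (by positivity)
  refine ⟨max MA MB + s / 8, by positivity, min δA δB, by positivity, min lamA lamB,
    by positivity, ?_⟩
  rintro xA ⟨hxA, hxA'⟩ xB ⟨hxB, hxB'⟩ t ⟨ht0, ht⟩ hts
  obtain ⟨a, ha, b, hb, hab⟩ := hcov _ (norm_neg_div_smul_self_le (xA - xB) hs.le)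
  obtain ⟨wA, hwA, hwA'⟩ := HA xA ⟨hxA, closedBall_subset_closedBall (min_le_left _ _) hxA'⟩ t
    ⟨ht0, ht.trans (min_le_left _ _)⟩ a ha
  obtain ⟨wB, hwB, hwB'⟩ := HB xB ⟨hxB, closedBall_subset_closedBall (min_le_right _ _) hxB'⟩ t
    ⟨ht0, ht.trans (min_le_right _ _)⟩ b hb
  rw [mem_closedBall, dist_eq_norm] at hwA hwB
  refine ⟨wA, wB, ?_, hwA', ?_, hwB', norm_add_smul_le_of_near ht0 hs hts ?_⟩
  · have h1 := norm_add_le (wA - a) a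
    rw [sub_add_cancel] at h1
    linarith [hMA a ha, le_max_left MA MB]
  · have h1 := norm_add_le (wB - b) b
    rw [sub_add_cancel] at h1
    linarith [hMB b hb, le_max_right MA MB]
  · generalize (-(s / ‖xA - xB‖)) • (xA - xB) = y at hab ⊢
    rw [show wA - wB - y = (wA - a) - (wB - b) + (a - b - y) by abel]
    have h1 := norm_add_le (wA - a - (wB - b)) (a - b - y)
    have h2 := norm_sub_le (wA - a) (wB - b)
    linarith

/-! ### Intersection of tangent cones -/

/-- The regularity of the pair `A`, `B` turns a common tangent direction of the two sets into a
tangent direction of their intersection. -/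
theorem inter_clarkeTangentCone_subset [CompleteSpace X] {A B DA DB : Set X} {x₀ : X}
    (hAc : IsClosed A) (hBc : IsClosed B) (hDA : Bornology.IsBounded DA)
    (hDB : Bornology.IsBounded DB) (hA : IsUniformTangentSet A x₀ DA)
    (hB : IsUniformTangentSet B x₀ DB) {s : ℝ} (hs : 0 < s)
    (hcov : ∀ x : X, ‖x‖ ≤ s → ∃ a ∈ DA, ∃ b ∈ DB, ‖a - b - x‖ ≤ s / 4) :
    clarkeTangentCone A x₀ ∩ clarkeTangentCone B x₀ ⊆ clarkeTangentCone (A ∩ B) x₀ := by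
  obtain ⟨M, hM, δ', hδ', lam, hlam, H⟩ := exists_linear_decrease hDA hDB hA hB hs hcov
  -- in `x₀ + δ 𝔹` the time needed to halve the distance is at most `lam`
  set δ := min δ' (lam * s / 2)
  have hδ : 0 < δ := by positivity
  have hK : 0 ≤ M / s := by positivity
  have hstep : ∀ xA ∈ A ∩ closedBall x₀ δ, ∀ xB ∈ B ∩ closedBall x₀ δ, ∃ yA ∈ A, ∃ yB ∈ B,
      ‖yA - xA‖ ≤ M / s * ‖xA - xB‖ ∧ ‖yB - xB‖ ≤ M / s * ‖xA - xB‖ ∧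
        ‖yA - yB‖ ≤ ‖xA - xB‖ / 2 := by
    rintro xA ⟨hxA, hxA'⟩ xB ⟨hxB, hxB'⟩
    have ht0 : 0 ≤ ‖xA - xB‖ / s := by positivity
    have ht : ‖xA - xB‖ / s ≤ lam := by
      rw [div_le_iff₀ hs, ← dist_eq_norm]
      have h1 := dist_triangle_right xA xB x₀
      rw [mem_closedBall] at hxA' hxB'
      have h2 := min_le_right δ' (lam * s / 2)
      linarith
    obtain ⟨wA, wB, hwA, hwA', hwB, hwB', hd⟩ := H xA
      ⟨hxA, closedBall_subset_closedBall (min_le_left _ _) hxA'⟩ xB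
      ⟨hxB, closedBall_subset_closedBall (min_le_left _ _) hxB'⟩ _ ⟨ht0, ht⟩
      (div_mul_cancel₀ _ hs.ne').le
    have hnorm : ∀ {w : X}, ‖w‖ ≤ M → ‖(‖xA - xB‖ / s) • w‖ ≤ M / s * ‖xA - xB‖ := by
      intro w hw
      rw [norm_smul, Real.norm_of_nonneg ht0]
      calc ‖xA - xB‖ / s * ‖w‖ ≤ ‖xA - xB‖ / s * M := by gcongr
        _ = M / s * ‖xA - xB‖ := by ring
    refine ⟨_, hwA', _, hwB', ?_, ?_, ?_⟩
    · rw [add_sub_cancel_left]; exact hnorm hwA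
    · rw [add_sub_cancel_left]; exact hnorm hwB
    · rw [show xA + (‖xA - xB‖ / s) • wA - (xB + (‖xA - xB‖ / s) • wB) =
        xA - xB + (‖xA - xB‖ / s) • (wA - wB) by module]
      refine hd.trans_eq ?_
      field_simp
      ring
  rintro v ⟨hvA, hvB⟩ ε hε
  set K := M / s
  -- if `xA` and `xB` are within `t ε₁` of `x + t v`, they are at most `2 t ε₁` apart, so that the
  -- common point is within `t ε₁ (4 K + 1) = t ε` of `x + t v`
  set ε₁ := ε / (4 * K + 1) with hε₁def
  have hε₁ : 0 < ε₁ := by positivity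
  obtain ⟨δA, hδA, lamA, hlamA, HA⟩ := hvA ε₁ hε₁
  obtain ⟨δB, hδB, lamB, hlamB, HB⟩ := hvB ε₁ hε₁
  refine ⟨min (δ / 2) (min δA δB), by positivity,
    min (δ / (2 * (‖v‖ + ε + 1))) (min lamA lamB), by positivity, ?_⟩
  rintro x ⟨⟨hxA, hxB⟩, hx⟩ t ⟨ht0, ht⟩
  rw [mem_closedBall] at hx
  simp only [le_min_iff] at hx ht
  obtain ⟨wA, hwA, hwA'⟩ := HA x ⟨hxA, hx.2.1⟩ t ⟨ht0, ht.2.1⟩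
  obtain ⟨wB, hwB, hwB'⟩ := HB x ⟨hxB, hx.2.2⟩ t ⟨ht0, ht.2.2⟩
  rw [mem_closedBall, dist_eq_norm] at hwA hwB
  rcases ht0.eq_or_lt with rfl | htpos
  · exact ⟨v, by simp [hε.le], by simpa using ⟨hxA, hxB⟩⟩
  have hsplit : ε₁ + 2 * K * (2 * ε₁) = ε := by
    rw [hε₁def]; field_simp; ring
  have hdiff : ‖x + t • wA - (x + t • wB)‖ ≤ 2 * ε₁ * t := by
    rw [add_sub_add_left_eq_sub, ← smul_sub, norm_smul, Real.norm_of_nonneg ht0, mul_comm]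
    gcongr
    rw [← sub_sub_sub_cancel_right wA wB v]
    linarith [norm_sub_le (wA - v) (wB - v)]
  have hnear : ∀ {w : X}, ‖w - v‖ ≤ ε₁ →
      ‖x + t • w - x₀‖ + 2 * K * ‖x + t • wA - (x + t • wB)‖ ≤ δ := by
    intro w hw
    have h1 : ‖x + t • w - x₀‖ ≤ δ / 2 + t * (‖v‖ + ε₁) := by
      rw [show x + t • w - x₀ = (x - x₀) + t • w by abel]
      refine (norm_add_le _ _).trans (add_le_add (by rw [← dist_eq_norm]; exact hx.1) ?_)
      rw [norm_smul, Real.norm_of_nonneg ht0]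
      gcongr
      have := norm_add_le (w - v) v
      rw [sub_add_cancel] at this
      linarith
    have h2 : 2 * K * ‖x + t • wA - (x + t • wB)‖ ≤ 2 * K * (2 * ε₁ * t) := by gcongr
    have h3 : t * (‖v‖ + ε) ≤ δ / 2 := by
      calc t * (‖v‖ + ε) ≤ δ / (2 * (‖v‖ + ε + 1)) * (‖v‖ + ε + 1) :=
            mul_le_mul ht.1 (by linarith) (by positivity) (by positivity)
        _ = δ / 2 := by field_simp
    have h4 : t * (‖v‖ + ε₁) + 2 * K * (2 * ε₁ * t) = t * (‖v‖ + ε) := by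
      rw [← hsplit]; ring
    linarith
  obtain ⟨y, hy, hyd⟩ := exists_mem_inter_of_halving hAc hBc hstep hK hwA' hwB' (hnear hwA)
    (hnear hwB)
  refine ⟨t⁻¹ • (y - x), ?_, by rwa [smul_inv_smul₀ htpos.ne', add_sub_cancel]⟩
  rw [mem_closedBall, dist_eq_norm, show t⁻¹ • (y - x) - v =
    t⁻¹ • (y - (x + t • wA)) + (wA - v) by
      rw [← sub_sub, smul_sub _ (y - x), inv_smul_smul₀ htpos.ne']; abel]
  refine (norm_add_le _ _).trans ?_
  have h5 : ‖t⁻¹ • (y - (x + t • wA))‖ ≤ 2 * K * (2 * ε₁) := by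
    rw [norm_smul, norm_inv, Real.norm_of_nonneg ht0, inv_mul_le_iff₀ htpos]
    calc ‖y - (x + t • wA)‖ ≤ 2 * K * (2 * ε₁ * t) := hyd.trans (by gcongr)
      _ = t * (2 * K * (2 * ε₁)) := by ring
  linarith

/-! ### Polars of intersections of convex cones -/

/-- For closed convex cones, an approximate covering of a ball by differences of bounded subsets
already gives an exact representation with control of the norm. -/
theorem ConvexCone.exists_sub_eq_of_cover [CompleteSpace X] {P Q : ConvexCone ℝ X}
    (hP : IsClosed (P : Set X)) (hQ : IsClosed (Q : Set X)) (hP0 : 0 ∈ P) (hQ0 : 0 ∈ Q)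
    {DA DB : Set X} (hDA : Bornology.IsBounded DA) (hDB : Bornology.IsBounded DB)
    (hA : DA ⊆ P) (hB : DB ⊆ Q) {s : ℝ} (hs : 0 < s)
    (hcov : ∀ x : X, ‖x‖ ≤ s → ∃ a ∈ DA, ∃ b ∈ DB, ‖a - b - x‖ ≤ s / 4) :
    ∃ K : ℝ, ∀ x : X, ∃ p ∈ P, ∃ q ∈ Q, p - q = x ∧ ‖q‖ ≤ K * ‖x‖ := by
  obtain ⟨MA, hMA0, hMA⟩ := hDA.exists_pos_norm_le
  obtain ⟨MB, hMB0, hMB⟩ := hDB.exists_pos_norm_le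
  set K := max MA MB / s with hKdef
  have hK : 0 ≤ K := by positivity
  refine ⟨2 * K + 1, fun x => ?_⟩
  -- the common point of `P` and `x + Q` is obtained by iteration from `0` and `x`
  have hQx : IsClosed {y | y - x ∈ Q} := hQ.preimage (by fun_prop : Continuous fun y => y - x)
  have hstep : ∀ xA ∈ (P : Set X) ∩ closedBall 0 (‖x‖ + 2 * K * ‖x‖),
      ∀ xB ∈ {y | y - x ∈ Q} ∩ closedBall 0 (‖x‖ + 2 * K * ‖x‖),
      ∃ yA ∈ (P : Set X), ∃ yB ∈ {y | y - x ∈ Q}, ‖yA - xA‖ ≤ K * ‖xA - xB‖ ∧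
        ‖yB - xB‖ ≤ K * ‖xA - xB‖ ∧ ‖yA - yB‖ ≤ ‖xA - xB‖ / 2 := by
    rintro xA ⟨hxA, -⟩ xB ⟨hxB, -⟩
    rcases eq_or_ne xA xB with rfl | hne
    · exact ⟨xA, hxA, xA, hxB, by simp⟩
    have hn : 0 < ‖xA - xB‖ := norm_pos_iff.2 (sub_ne_zero.2 hne)
    have ht : 0 < ‖xA - xB‖ / s := by positivity
    obtain ⟨a, ha, b, hb, hab⟩ := hcov _ (norm_neg_div_smul_self_le (xA - xB) hs.le)
    have hnorm : ∀ {w : X}, ‖w‖ ≤ max MA MB → ‖(‖xA - xB‖ / s) • w‖ ≤ K * ‖xA - xB‖ := by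
      intro w hw
      rw [norm_smul, Real.norm_of_nonneg ht.le]
      calc ‖xA - xB‖ / s * ‖w‖ ≤ ‖xA - xB‖ / s * max MA MB := by gcongr
        _ = K * ‖xA - xB‖ := by rw [hKdef]; ring
    refine ⟨xA + (‖xA - xB‖ / s) • a, P.add_mem hxA (P.smul_mem ht (hA ha)),
      xB + (‖xA - xB‖ / s) • b, ?_, ?_, ?_, ?_⟩
    · have := Q.add_mem hxB (Q.smul_mem ht (hB hb))
      rwa [sub_add_eq_add_sub] at this
    · rw [add_sub_cancel_left]; exact hnorm ((hMA a ha).trans (le_max_left _ _))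
    · rw [add_sub_cancel_left]; exact hnorm ((hMB b hb).trans (le_max_right _ _))
    · rw [show xA + (‖xA - xB‖ / s) • a - (xB + (‖xA - xB‖ / s) • b) =
        xA - xB + (‖xA - xB‖ / s) • (a - b) by module]
      refine (norm_add_smul_le_of_near ht.le hs (div_mul_cancel₀ _ hs.ne').le
        (hab.trans (by linarith))).trans_eq ?_
      field_simp
      ring
  obtain ⟨y, ⟨hyP, hyQ⟩, hy⟩ := exists_mem_inter_of_halving (xA := 0) (xB := x) hP hQx hstep hK
    hP0 (by simpa using hQ0) (by simp) (by simp)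
  refine ⟨y, hyP, y - x, hyQ, sub_sub_cancel _ _, ?_⟩
  have := norm_sub_le y x
  simp only [sub_zero, zero_sub, norm_neg] at hy
  linarith

/-- If every `x` is a difference `p - q` with `p ∈ P`, `q ∈ Q` and `‖q‖ ≤ K ‖x‖`, then the polar of
`P ∩ Q` is the sum of the polars: `g` is obtained by the Hahn-Banach theorem below the sublinear
functional `x ↦ inf {-f q | p - q = x}`. -/
theorem ConvexCone.exists_add_of_nonpos_inter {P Q : ConvexCone ℝ X} {K : ℝ}
    (hPQ : ∀ x : X, ∃ p ∈ P, ∃ q ∈ Q, p - q = x ∧ ‖q‖ ≤ K * ‖x‖) (hP0 : 0 ∈ P) (hQ0 : 0 ∈ Q)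
    (f : X →L[ℝ] ℝ) (hf : ∀ v, v ∈ P → v ∈ Q → f v ≤ 0) :
    ∃ g h : X →L[ℝ] ℝ, (∀ v ∈ P, g v ≤ 0) ∧ (∀ v ∈ Q, h v ≤ 0) ∧ g + h = f := by
  let V : X → Set ℝ := fun x => {c | ∃ p ∈ P, ∃ q ∈ Q, p - q = x ∧ -f q = c}
  have hne : ∀ x, (V x).Nonempty := fun x =>
    let ⟨p, hp, q, hq, h, _⟩ := hPQ x
    ⟨_, p, hp, q, hq, h, rfl⟩
  have hbdd : ∀ x, BddBelow (V x) := by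
    intro x
    -- for `-x = p' - q'` the vector `q + q' = p + p'` belongs to both cones
    obtain ⟨p', hp', q', hq', h', -⟩ := hPQ (-x)
    refine ⟨f q', ?_⟩
    rintro _ ⟨p, hp, q, hq, h, rfl⟩
    have hpq : q + q' = p + p' := by
      rw [← sub_eq_zero, show q + q' - (p + p') = -((p - q) + (p' - q')) by abel, h, h']
      simp
    have := hf (q + q') (hpq ▸ P.add_mem hp hp') (Q.add_mem hq hq')
    rw [map_add] at this
    linarith
  let N : X → ℝ := fun x => sInf (V x)
  have hN : ∀ {p q : X}, p ∈ P → q ∈ Q → N (p - q) ≤ -f q := fun hp hq =>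
    csInf_le (hbdd _) ⟨_, hp, _, hq, rfl, rfl⟩
  have hNsmul_le : ∀ c : ℝ, 0 < c → ∀ x, N (c • x) ≤ c * N x := by
    intro c hc x
    rw [← div_le_iff₀' hc]
    refine le_csInf (hne x) ?_
    rintro _ ⟨p, hp, q, hq, rfl, rfl⟩
    rw [div_le_iff₀' hc, smul_sub]
    refine (hN (P.smul_mem hc hp) (Q.smul_mem hc hq)).trans_eq ?_
    simp
  have hNsmul : ∀ c : ℝ, 0 < c → ∀ x, N (c • x) = c * N x := by
    refine fun c hc x => (hNsmul_le c hc x).antisymm ?_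
    have := hNsmul_le c⁻¹ (inv_pos.2 hc) (c • x)
    rwa [inv_smul_smul₀ hc.ne', ← div_eq_inv_mul, le_div_iff₀' hc] at this
  have hNadd : ∀ x y, N (x + y) ≤ N x + N y := by
    intro x y
    rw [← sub_le_iff_le_add]
    refine le_csInf (hne x) ?_
    rintro _ ⟨p, hp, q, hq, rfl, rfl⟩
    rw [sub_le_comm]
    refine le_csInf (hne y) ?_
    rintro _ ⟨p', hp', q', hq', rfl, rfl⟩
    have := hN (P.add_mem hp hp') (Q.add_mem hq hq')
    rw [add_sub_add_comm, map_add] at this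
    linarith
  have hNnorm : ∀ x, N x ≤ ‖f‖ * K * ‖x‖ := by
    intro x
    obtain ⟨p, hp, q, hq, rfl, hqx⟩ := hPQ x
    calc N (p - q) ≤ -f q := hN hp hq
      _ ≤ ‖f q‖ := neg_le_abs _
      _ ≤ ‖f‖ * ‖q‖ := f.le_opNorm q
      _ ≤ ‖f‖ * (K * ‖p - q‖) := by gcongr
      _ = _ := by ring
  have hN0 : 0 ≤ N 0 := by
    have := hNsmul 2 two_pos 0
    rw [smul_zero] at this
    linarith
  obtain ⟨g, -, hg⟩ := exists_extension_of_le_sublinear (⊥ : X →ₗ.[ℝ] ℝ) N hNsmul hNadd (by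
    rintro ⟨x, hx⟩
    obtain rfl : x = 0 := (Submodule.mem_bot ℝ).1 hx
    rw [show (⟨0, hx⟩ : (⊥ : X →ₗ.[ℝ] ℝ).domain) = 0 from rfl, LinearPMap.map_zero]
    exact hN0)
  let g' : X →L[ℝ] ℝ := g.mkContinuous (‖f‖ * K) fun x => by
    rw [Real.norm_eq_abs, abs_le]
    refine ⟨?_, (hg x).trans (hNnorm x)⟩
    have := (hg (-x)).trans (hNnorm (-x))
    rw [map_neg, norm_neg] at this
    linarith
  refine ⟨g', f - g', fun v hv => ?_, fun v hv => ?_, by abel⟩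
  · have := (hg (v - 0)).trans (hN hv hQ0)
    rwa [sub_zero, map_zero, neg_zero] at this
  · have := (hg (0 - v)).trans (hN hP0 hv)
    rw [zero_sub, map_neg] at this
    change f v - g v ≤ 0
    linarith

end

/-! ### Tangential transversality and the normal intersection property -/

theorem mainTheorem5 {X : Type*} [NormedAddCommGroup X] [NormedSpace ℝ X] [CompleteSpace X]
    (A B : Set X) (hA : IsClosed A) (hB : IsClosed B) (x₀ : X) (hx₀ : x₀ ∈ A ∩ B)
    (hell : EpiLipschitzLike A x₀)
    (hdense : Dense (clarkeTangentCone A x₀ - clarkeTangentCone B x₀)) :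
    TangentiallyTransversal A B x₀ ∧
      NormalIntersectionProperty clarkeNormalCone A B x₀ := by
  obtain ⟨DA, DB, hDA, hDB, hUA, hUB, s, hs, hcov⟩ := exists_isUniformTangentSet_cover hell hdense
  constructor
  · obtain ⟨M, hM, δ, hδ, lam, hlam, H⟩ := exists_linear_decrease hDA hDB hUA hUB hs hcov
    refine ⟨M, hM, δ, hδ, s / 2, by positivity, fun xA hxA xB hxB hne => ?_⟩
    have hn : 0 < ‖xA - xB‖ := norm_pos_iff.2 (sub_ne_zero.2 hne)
    obtain ⟨t, ht, ht0, htt⟩ :=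
      exists_seq_strictAnti_tendsto' (show 0 < min lam (‖xA - xB‖ / s) by positivity)
    refine ⟨t, fun m => (ht0 m).1, ht, htt, fun m => ?_⟩
    have htm := (ht0 m).2.le
    rw [le_min_iff, le_div_iff₀ hs] at htm
    exact H xA hxA.symm xB hxB.symm (t m) ⟨(ht0 m).1.le, htm.1⟩ htm.2
  · have hcone := inter_clarkeTangentCone_subset hA hB hDA hDB hUA hUB hs hcov
    have hsum : clarkeNormalCone A x₀ + clarkeNormalCone B x₀ = {f : WeakDual ℝ X |
        ∀ v ∈ clarkeTangentCone A x₀ ∩ clarkeTangentCone B x₀, f v ≤ 0} := by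
      refine Set.Subset.antisymm ?_ fun f hf => ?_
      · rintro _ ⟨g, hg, h, hh, rfl⟩ v ⟨hvA, hvB⟩
        exact add_nonpos (hg v hvA) (hh v hvB)
      · obtain ⟨K, hK⟩ := ConvexCone.exists_sub_eq_of_cover (P := clarkeTangentConvexCone A x₀)
          (Q := clarkeTangentConvexCone B x₀) (isClosed_clarkeTangentCone A x₀)
          (isClosed_clarkeTangentCone B x₀) (zero_mem_clarkeTangentCone A x₀)
          (zero_mem_clarkeTangentCone B x₀) hDA hDB hUA.subset_clarkeTangentCone
          hUB.subset_clarkeTangentCone hs hcov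
        obtain ⟨g, h, hg, hh, hgh⟩ := ConvexCone.exists_add_of_nonpos_inter hK
          (zero_mem_clarkeTangentCone A x₀) (zero_mem_clarkeTangentCone B x₀)
          (WeakDual.toStrongDual f) fun v hvA hvB => hf v ⟨hvA, hvB⟩
        exact ⟨StrongDual.toWeakDual g, hg, StrongDual.toWeakDual h, hh, hgh⟩
    rw [NormalIntersectionProperty, hsum]
    refine ⟨fun f hf v hv => hf v (hcone hv), ?_⟩
    simp only [Set.ofPred_forall]
    exact isClosed_biInter fun v _ => isClosed_Iic.preimage (WeakDual.eval_continuous v)
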